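/- Let $c_1>0$ and $c_3,c_4,c_5$ be real numbers. There is a constant $c_0>0$, depending only on $c_1,c_3,c_4,c_5$, with the following property. Let $\Sigma$ be an $n$-dimensional smooth manifold without boundary (not necessarily compact) and let $F_s:\Sigma\to\mathbb{R}^{n+m}$, $s\in[0,T]$, be a smooth mean curvature flow, that is, a smooth family of immersions with $\frac{d}{ds}F_s(x)=H(x,s)$, the mean curvature vector of $F_s$ at $x$. Let $\Delta$ and $\nabla$ be the Laplace operator and the gradient of the metric induced by $F_s$ on $\Sigma$, and let $\frac{d}{dt}$ be the time derivative at a fixed point of $\Sigma$. All functions below are functions of $(x,s)\in\Sigma\times[0,T]$ that are jointly continuous, $C^2$ in $x$ and differentiable in $s$. Let $r\ge 0$ satisfy $$\left|\left(\tfrac{d}{dt}-\Delta\right)r\right|\le c_4,\qquad |\nabla r|^2\le c_5\,r .$$ Let $h>0$ and $0<f\le c_3$ satisfy $$\left(\tfrac{d}{dt}-\Delta\right)h\le c_1h^3,\qquad \left(\tfrac{d}{dt}-\Delta\right)f\ge c_2 f h^2$$ for a constant $c_2$ with $0<c_1\le c_2$. Let $0<t\le T$, let $0<\theta<1$, and let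 $R>0$ be such that $\{(x,s)\in\Sigma\times[0,t] : r(x,s)\le R^2\}$ is compact (this is automatic if $\Sigma$ is compact). Then $$\sup_{\{x\,:\,r(x,t)\le\theta R^2\}} h(x,t)^2\;\le\; c_0\,(1-\theta)^{-2}\left(t^{-1}+R^{-2}\right)\,\sup_{s\in[0,t]}\ \sup_{\{x\,:\,r(x,s)\le R^2\}}\frac{1}{f(x,s)^4},$$ where suprema are taken in $[0,\infty]$ and the supremum over the empty set is $0$. -/

import Mathlib

open Set
open scoped Manifold ContDiff ENNReal

noncomputable section

namespace EvolvingSubmanifold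

/-! ### Local coordinate expressions

`Φ : ℝⁿ → ℝᴺ` is a local parametrization, with partial derivatives `∂ᵢΦ`. -/

section Local

variable {n N : ℕ} {V : Type*} [NormedAddCommGroup V] [NormedSpace ℝ V]

/-- The `i`-th partial derivative `∂ᵢ v` of a function on `ℝⁿ`. -/
def partialDeriv (i : Fin n) (v : EuclideanSpace ℝ (Fin n) → V) :
    EuclideanSpace ℝ (Fin n) → V :=
  fun y => fderiv ℝ v y (EuclideanSpace.single i 1)

/-- The induced metric `g_{ij} = ⟨∂ᵢΦ, ∂ⱼΦ⟩`. -/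
def inducedMetric (Φ : EuclideanSpace ℝ (Fin n) → EuclideanSpace ℝ (Fin N))
    (y : EuclideanSpace ℝ (Fin n)) : Matrix (Fin n) (Fin n) ℝ :=
  Matrix.of fun i j => inner ℝ (partialDeriv i Φ y) (partialDeriv j Φ y)

/-- The Christoffel symbols of the induced metric,
`Γᵏ_{ij} = ½ ∑ₗ gᵏˡ (∂ᵢ g_{jl} + ∂ⱼ g_{il} - ∂ₗ g_{ij})`. -/
def christoffel (Φ : EuclideanSpace ℝ (Fin n) → EuclideanSpace ℝ (Fin N))
    (y : EuclideanSpace ℝ (Fin n)) (k i j : Fin n) : ℝ :=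
  (1 / 2 : ℝ) * ∑ l, (inducedMetric Φ y)⁻¹ k l *
    (partialDeriv i (fun z => inducedMetric Φ z j l) y
      + partialDeriv j (fun z => inducedMetric Φ z i l) y
      - partialDeriv l (fun z => inducedMetric Φ z i j) y)

/-- The Laplace operator of the induced metric in coordinates,
`∑ gⁱʲ (∂ᵢ∂ⱼ v - ∑ₖ Γᵏ_{ij} ∂ₖ v)`. -/
def localLaplacian (Φ : EuclideanSpace ℝ (Fin n) → EuclideanSpace ℝ (Fin N))
    (v : EuclideanSpace ℝ (Fin n) → ℝ) (y : EuclideanSpace ℝ (Fin n)) : ℝ :=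
  ∑ i, ∑ j, (inducedMetric Φ y)⁻¹ i j *
    (partialDeriv i (partialDeriv j v) y
      - ∑ k, christoffel Φ y k i j * partialDeriv k v y)

/-- `|∇v|² = ∑ gⁱʲ ∂ᵢv ∂ⱼv` with respect to the induced metric. -/
def localGradSq (Φ : EuclideanSpace ℝ (Fin n) → EuclideanSpace ℝ (Fin N))
    (v : EuclideanSpace ℝ (Fin n) → ℝ) (y : EuclideanSpace ℝ (Fin n)) : ℝ :=
  ∑ i, ∑ j, (inducedMetric Φ y)⁻¹ i j * partialDeriv i v y * partialDeriv j v y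

/-- The projection to the normal space,
`P w = w - ∑ gᵏˡ ⟨∂ₗΦ, w⟩ ∂ₖΦ`. -/
def normalProj (Φ : EuclideanSpace ℝ (Fin n) → EuclideanSpace ℝ (Fin N))
    (y : EuclideanSpace ℝ (Fin n)) (w : EuclideanSpace ℝ (Fin N)) :
    EuclideanSpace ℝ (Fin N) :=
  w - ∑ k, ∑ l, ((inducedMetric Φ y)⁻¹ k l * inner ℝ (partialDeriv l Φ y) w) •
    partialDeriv k Φ y

/-- The mean curvature vector `H = ∑ gⁱʲ P(∂ᵢ∂ⱼΦ)` in coordinates. -/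
def localMeanCurvature (Φ : EuclideanSpace ℝ (Fin n) → EuclideanSpace ℝ (Fin N))
    (y : EuclideanSpace ℝ (Fin n)) : EuclideanSpace ℝ (Fin N) :=
  ∑ i, ∑ j, (inducedMetric Φ y)⁻¹ i j •
    normalProj Φ y (partialDeriv i (partialDeriv j Φ) y)

end Local

/-! ### Immersed submanifolds

The geometric quantities below do not depend on the chart; at the point `x` they are computed
in the preferred chart around `x`. -/

section Immersed

variable {n N : ℕ} {M : Type*} [TopologicalSpace M]
  [ChartedSpace (EuclideanSpace ℝ (Fin n)) M]

/-- The Laplace operator of the metric induced by the immersion `F`, applied to `u`. -/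
def laplaceBeltrami (F : M → EuclideanSpace ℝ (Fin N)) (u : M → ℝ) (x : M) : ℝ :=
  localLaplacian (F ∘ (extChartAt (𝓡 n) x).symm) (u ∘ (extChartAt (𝓡 n) x).symm)
    (extChartAt (𝓡 n) x x)

/-- `|∇u|²` with respect to the metric induced by the immersion `F`. -/
def gradSq (F : M → EuclideanSpace ℝ (Fin N)) (u : M → ℝ) (x : M) : ℝ :=
  localGradSq (F ∘ (extChartAt (𝓡 n) x).symm) (u ∘ (extChartAt (𝓡 n) x).symm)
    (extChartAt (𝓡 n) x x)

/-- The mean curvature vector of the immersion `F`. -/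
def meanCurvature (F : M → EuclideanSpace ℝ (Fin N)) (x : M) : EuclideanSpace ℝ (Fin N) :=
  localMeanCurvature (F ∘ (extChartAt (𝓡 n) x).symm) (extChartAt (𝓡 n) x x)

/-- `F : [0, T] × M → ℝᴺ` is a smooth mean curvature flow of immersions. -/
structure IsMeanCurvatureFlow (T : ℝ) (F : ℝ → M → EuclideanSpace ℝ (Fin N)) : Prop where
  smooth : ContMDiffOn ((𝓡 n).prod 𝓘(ℝ, ℝ)) 𝓘(ℝ, EuclideanSpace ℝ (Fin N)) ∞
    (fun p : M × ℝ => F p.2 p.1) (univ ×ˢ Icc 0 T)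
  immersion : ∀ s ∈ Icc 0 T, ∀ x : M,
    Function.Injective (mfderiv (𝓡 n) 𝓘(ℝ, EuclideanSpace ℝ (Fin N)) (F s) x)
  evolution : ∀ s ∈ Icc 0 T, ∀ x : M,
    HasDerivWithinAt (fun τ => F τ x) (meanCurvature (n := n) (F s) x) (Icc 0 T) s

/-- Regularity of a function on the evolving submanifold: jointly continuous, `C²` in space at each
time and differentiable in time at each point. Every jointly `C²` function has it. -/
structure IsRegular (n : ℕ) {M : Type*} [TopologicalSpace M]
    [ChartedSpace (EuclideanSpace ℝ (Fin n)) M] (T : ℝ) (u : ℝ → M → ℝ) : Prop where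
  continuousOn : ContinuousOn (fun p : M × ℝ => u p.2 p.1) (univ ×ˢ Icc 0 T)
  space : ∀ s ∈ Icc 0 T, ContMDiff (𝓡 n) 𝓘(ℝ, ℝ) 2 (u s)
  time : ∀ x : M, DifferentiableOn ℝ (fun τ => u τ x) (Icc 0 T)

/-- `(d/dt - Δ) u` at the point `x` and time `s`: the time derivative is taken at fixed `x`
(one-sided at the end points of `[0, T]`), and `Δ` is the Laplace operator of the metric induced
by `F s`. -/
def heatOp (T : ℝ) (F : ℝ → M → EuclideanSpace ℝ (Fin N)) (u : ℝ → M → ℝ) (s : ℝ) (x : M) : ℝ :=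
  derivWithin (fun τ => u τ x) (Icc 0 T) s - laplaceBeltrami (n := n) (F s) (u s) x

end Immersed

end EvolvingSubmanifold

end

open Filter Topology

namespace EvolvingSubmanifold

/-! ### Calculus of the induced metric in coordinates, and conditions at a spatial maximum -/

section Local

variable {n N : ℕ} {Φ : EuclideanSpace ℝ (Fin n) → EuclideanSpace ℝ (Fin N)}
  {u v : EuclideanSpace ℝ (Fin n) → ℝ} {y : EuclideanSpace ℝ (Fin n)}

/-! The proof is a localized maximum principle in the style of Ecker and Huisken. Put `ρ = R²`, let
`m` be the minimum of `f` over the compact set `{r ≤ ρ}` in `[0, t]`, put `k = m² / 2`, and maximize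
`s (ρ - r)² h² / (f² - k)` over that set. The maximum is positive, so it occurs with `s > 0` and `r
< ρ`, where its logarithm can be differentiated.

In space, `∇log = 0` expresses `∇h` through `∇r` and `∇f`. In `Δlog ≤ 0`, Young's inequality with
weight `k / f²` then cancels `|∇f|²` exactly and leaves only `|∇r|² / (ρ - r)²`
(`localLaplacian_le_of_isLocalMax_logBarrier`). In time, the one-sided derivative is nonnegative.
Combining the two, the reaction terms add up to `2c₁h² - 2c₁f²h²/(f² - k) = -2c₁k h²/(f² - k)`, a
good term because `k > 0`; it bounds the maximum (`barrier_le_of_heat_bounds`). Comparison with the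
value at `(x, t)`, where `ρ - r ≥ (1 - θ)ρ`, gives the estimate with `1 / m⁴`, a value of `1 / f⁴`
on the set. -/

theorem exists_inv_inducedMetric_eq_sum (Φ : EuclideanSpace ℝ (Fin n) → EuclideanSpace ℝ (Fin N))
    (y : EuclideanSpace ℝ (Fin n)) :
    ∃ C : Fin n → Fin n → ℝ, ∀ i j, (inducedMetric Φ y)⁻¹ i j = ∑ k, C k i * C k j := by
  have hB : (inducedMetric Φ y)⁻¹.PosSemidef :=
    (Matrix.posSemidef_gram ℝ fun i => partialDeriv i Φ y).inv
  open scoped MatrixOrder in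
  obtain ⟨C, hC⟩ := CStarAlgebra.nonneg_iff_eq_star_mul_self.mp hB.nonneg
  exact ⟨C, fun i j => by rw [hC]; simp [Matrix.mul_apply, Matrix.star_apply]⟩

theorem partialDeriv_add (hu : DifferentiableAt ℝ u y) (hv : DifferentiableAt ℝ v y) (i : Fin n) :
    partialDeriv i (u + v) y = partialDeriv i u y + partialDeriv i v y := by
  simp [partialDeriv, fderiv_add hu hv]

theorem partialDeriv_comp {φ : ℝ → ℝ} {φ' : ℝ} (hφ : HasDerivAt φ φ' (v y))
    (hv : DifferentiableAt ℝ v y) (i : Fin n) :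
    partialDeriv i (φ ∘ v) y = φ' * partialDeriv i v y := by
  rw [partialDeriv, (hφ.comp_hasFDerivAt y hv.hasFDerivAt).fderiv]
  simp [partialDeriv]

theorem eventually_differentiableAt (hv : ContDiffAt ℝ 2 v y) :
    ∀ᶠ z in 𝓝 y, DifferentiableAt ℝ v z :=
  (hv.eventually (by simp)).mono fun _ hz => hz.differentiableAt (by simp)

theorem differentiableAt_fderiv (hv : ContDiffAt ℝ 2 v y) :
    DifferentiableAt ℝ (fderiv ℝ v) y :=
  (hv.fderiv_right (m := 1) (by norm_num)).differentiableAt (by simp)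

theorem differentiableAt_partialDeriv (hv : ContDiffAt ℝ 2 v y) (i : Fin n) :
    DifferentiableAt ℝ (partialDeriv i v) y :=
  (differentiableAt_fderiv hv).clm_apply (differentiableAt_const _)

theorem partialDeriv_congr {V : Type*} [NormedAddCommGroup V] [NormedSpace ℝ V]
    {u v : EuclideanSpace ℝ (Fin n) → V} (h : u =ᶠ[𝓝 y] v) (i : Fin n) :
    partialDeriv i u y = partialDeriv i v y := by
  rw [partialDeriv, partialDeriv, h.fderiv_eq]

theorem partialDeriv_partialDeriv_eq (hv : ContDiffAt ℝ 2 v y) (i j : Fin n) :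
    partialDeriv i (partialDeriv j v) y =
      fderiv ℝ (fderiv ℝ v) y (EuclideanSpace.single i 1) (EuclideanSpace.single j 1) := by
  have := ((differentiableAt_fderiv hv).hasFDerivAt.clm_apply
    (hasFDerivAt_const (EuclideanSpace.single j (1 : ℝ)) y)).fderiv
  change fderiv ℝ (fun z => fderiv ℝ v z (EuclideanSpace.single j 1)) y _ = _
  rw [this]
  simp

theorem partialDeriv_partialDeriv_add (hu : ContDiffAt ℝ 2 u y) (hv : ContDiffAt ℝ 2 v y)
    (i j : Fin n) :
    partialDeriv i (partialDeriv j (u + v)) y =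
      partialDeriv i (partialDeriv j u) y + partialDeriv i (partialDeriv j v) y := by
  rw [← partialDeriv_add (differentiableAt_partialDeriv hu j) (differentiableAt_partialDeriv hv j)]
  refine partialDeriv_congr ?_ i
  filter_upwards [eventually_differentiableAt hu, eventually_differentiableAt hv] with z h1 h2
  exact partialDeriv_add h1 h2 j

theorem partialDeriv_partialDeriv_comp {φ φ' : ℝ → ℝ} {φ'' : ℝ}
    (hφ : ∀ᶠ a in 𝓝 (v y), HasDerivAt φ (φ' a) a) (hφ' : HasDerivAt φ' φ'' (v y))
    (hv : ContDiffAt ℝ 2 v y) (i j : Fin n) :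
    partialDeriv i (partialDeriv j (φ ∘ v)) y =
      φ'' * partialDeriv i v y * partialDeriv j v y
        + φ' (v y) * partialDeriv i (partialDeriv j v) y := by
  have hv1 := hv.differentiableAt (by simp)
  have h : partialDeriv j (φ ∘ v) =ᶠ[𝓝 y] fun z => φ' (v z) * partialDeriv j v z := by
    filter_upwards [eventually_differentiableAt hv, hv.continuousAt.eventually hφ] with z h1 h2
    exact partialDeriv_comp h2 h1 j
  have h' : HasFDerivAt (fun z => φ' (v z) * partialDeriv j v z) _ y :=
    (hφ'.comp_hasFDerivAt y hv1.hasFDerivAt).mul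
      (differentiableAt_partialDeriv hv j).hasFDerivAt
  rw [partialDeriv_congr h, partialDeriv, h'.fderiv]
  simp [partialDeriv]
  ring

theorem localLaplacian_add (hu : ContDiffAt ℝ 2 u y) (hv : ContDiffAt ℝ 2 v y) :
    localLaplacian Φ (u + v) y = localLaplacian Φ u y + localLaplacian Φ v y := by
  simp only [localLaplacian, ← Finset.sum_add_distrib]
  refine Finset.sum_congr rfl fun i _ => Finset.sum_congr rfl fun j _ => ?_
  rw [partialDeriv_partialDeriv_add hu hv, ← mul_add]
  simp only [partialDeriv_add (hu.differentiableAt (by simp)) (hv.differentiableAt (by simp)),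
    mul_add, Finset.sum_add_distrib]
  ring

theorem localLaplacian_comp {φ φ' : ℝ → ℝ} {φ'' : ℝ}
    (hφ : ∀ᶠ a in 𝓝 (v y), HasDerivAt φ (φ' a) a) (hφ' : HasDerivAt φ' φ'' (v y))
    (hv : ContDiffAt ℝ 2 v y) :
    localLaplacian Φ (φ ∘ v) y = φ' (v y) * localLaplacian Φ v y + φ'' * localGradSq Φ v y := by
  simp only [localLaplacian, localGradSq, Finset.mul_sum, ← Finset.sum_add_distrib]
  refine Finset.sum_congr rfl fun i _ => Finset.sum_congr rfl fun j _ => ?_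
  rw [partialDeriv_partialDeriv_comp hφ hφ' hv]
  have : ∑ k, christoffel Φ y k i j * partialDeriv k (φ ∘ v) y
      = φ' (v y) * ∑ k, christoffel Φ y k i j * partialDeriv k v y := by
    rw [Finset.mul_sum]
    refine Finset.sum_congr rfl fun k _ => ?_
    rw [partialDeriv_comp hφ.self_of_nhds (hv.differentiableAt (by simp))]
    ring
  rw [this]
  ring

theorem partialDeriv_eq_zero_of_isLocalMax (h : IsLocalMax v y) (i : Fin n) :
    partialDeriv i v y = 0 := by
  simp [partialDeriv, h.fderiv_eq_zero]

/-- The second derivative at a local maximum is nonpositive. -/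
theorem _root_.IsLocalMax.deriv_deriv_nonpos {g : ℝ → ℝ} {a : ℝ} (h : IsLocalMax g a)
    (hg : ContinuousAt g a) : deriv (deriv g) a ≤ 0 := by
  by_contra! hpos
  -- With a positive second derivative the maximum would also be a local minimum, so `g` would be
  -- locally constant.
  have hmin := isLocalMin_of_deriv_deriv_pos hpos h.deriv_eq_zero hg
  have hconst : g =ᶠ[𝓝 a] fun _ => g a := by
    filter_upwards [h, hmin] with z h1 h2 using le_antisymm h1 h2
  have := hconst.deriv.deriv_eq
  simp at this
  exact hpos.ne' this

/-- Restriction to the line `τ ↦ y + τ w` reduces this to one variable. -/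
theorem _root_.IsLocalMax.fderiv_fderiv_nonpos {E : Type*} [NormedAddCommGroup E]
    [NormedSpace ℝ E] {u : E → ℝ} {y : E} (h : IsLocalMax u y) (hu : ContDiffAt ℝ 2 u y) (w : E) :
    fderiv ℝ (fderiv ℝ u) y w w ≤ 0 := by
  have hγ (τ : ℝ) : HasDerivAt (fun τ : ℝ => y + τ • w) w τ := by
    simpa using ((hasDerivAt_id τ).smul_const w).const_add y
  have hγ0 : Tendsto (fun τ : ℝ => y + τ • w) (𝓝 0) (𝓝 y) := by
    simpa [ContinuousAt] using (hγ 0).continuousAt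
  have hy : y + (0 : ℝ) • w = y := by simp
  have hmax : IsLocalMax (fun τ : ℝ => u (y + τ • w)) 0 := by
    simpa [IsLocalMax, IsMaxFilter] using hγ0.eventually h
  have hd : deriv (fun τ : ℝ => u (y + τ • w)) =ᶠ[𝓝 0] fun τ => fderiv ℝ u (y + τ • w) w := by
    have := hγ0.eventually (hu.eventually (by simp))
    filter_upwards [this] with τ hτ
    exact ((hτ.differentiableAt (by simp)).hasFDerivAt.comp_hasDerivAt τ (hγ τ)).deriv
  have hdd : HasDerivAt (fun τ : ℝ => fderiv ℝ u (y + τ • w) w) (fderiv ℝ (fderiv ℝ u) y w w) 0 := by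
    have h2 : HasFDerivAt (fderiv ℝ u) (fderiv ℝ (fderiv ℝ u) y) (y + (0 : ℝ) • w) := by
      rw [hy]
      exact ((hu.fderiv_right (m := 1) (by norm_num)).differentiableAt (by simp)).hasFDerivAt
    have h3 : HasDerivAt (fun τ : ℝ => fderiv ℝ u (y + τ • w)) (fderiv ℝ (fderiv ℝ u) y w) 0 :=
      h2.comp_hasDerivAt (0 : ℝ) (hγ 0)
    have h4 : fderiv ℝ (fderiv ℝ u) y w w =
        fderiv ℝ (fderiv ℝ u) y w w + fderiv ℝ u (y + (0 : ℝ) • w) 0 := by simp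
    rw [h4]
    exact h3.clm_apply (hasDerivAt_const (0 : ℝ) w)
  have hcont : ContinuousAt (fun τ : ℝ => u (y + τ • w)) 0 :=
    ContinuousAt.comp (by rw [hy]; exact hu.continuousAt) (hγ 0).continuousAt
  rw [← hdd.deriv, ← hd.deriv_eq]
  exact hmax.deriv_deriv_nonpos hcont

/-- The Christoffel terms vanish with the gradient, and `g⁻¹ = CᵀC` turns the rest into a sum of
second derivatives along the rows of `C`. -/
theorem localLaplacian_nonpos_of_isLocalMax (h : IsLocalMax v y) (hv : ContDiffAt ℝ 2 v y) :
    localLaplacian Φ v y ≤ 0 := by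
  obtain ⟨C, hC⟩ := exists_inv_inducedMetric_eq_sum Φ y
  have key : localLaplacian Φ v y = ∑ k, fderiv ℝ (fderiv ℝ v) y
      (∑ i, C k i • EuclideanSpace.single i 1) (∑ i, C k i • EuclideanSpace.single i 1) := by
    simp only [localLaplacian, partialDeriv_eq_zero_of_isLocalMax h, hC, mul_zero,
      Finset.sum_const_zero, sub_zero, partialDeriv_partialDeriv_eq hv, map_sum, map_smul,
      sum_apply, smul_apply, Finset.sum_mul,
      smul_eq_mul, Finset.mul_sum]
    rw [Finset.sum_comm_cycle]
    refine Finset.sum_congr rfl fun k _ => ?_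
    rw [Finset.sum_comm]
    refine Finset.sum_congr rfl fun i _ => Finset.sum_congr rfl fun j _ => ?_
    ring
  rw [key]
  exact Finset.sum_nonpos fun k _ => h.fderiv_fderiv_nonpos hv _

theorem localGradSq_eq_sum_sq {C : Fin n → Fin n → ℝ}
    (hC : ∀ i j, (inducedMetric Φ y)⁻¹ i j = ∑ k, C k i * C k j) :
    localGradSq Φ v y = ∑ k, (∑ i, C k i * partialDeriv i v y) ^ 2 := by
  simp only [localGradSq, hC, sq, Finset.sum_mul, Finset.mul_sum]
  rw [Finset.sum_comm_cycle]
  refine Finset.sum_congr rfl fun k _ => ?_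
  rw [Finset.sum_comm]
  refine Finset.sum_congr rfl fun i _ => Finset.sum_congr rfl fun j _ => ?_
  ring

/-- If `∇w = α ∇u + β ∇v` then `|∇w|² ≤ (1 + ε⁻¹) α² |∇u|² + (1 + ε) β² |∇v|²`. -/
theorem localGradSq_le_of_partialDeriv_eq {w : EuclideanSpace ℝ (Fin n) → ℝ} {α β ε : ℝ}
    (hε : 0 < ε)
    (h : ∀ i, partialDeriv i w y = α * partialDeriv i u y + β * partialDeriv i v y) :
    localGradSq Φ w y ≤
      (1 + ε⁻¹) * α ^ 2 * localGradSq Φ u y + (1 + ε) * β ^ 2 * localGradSq Φ v y := by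
  obtain ⟨C, hC⟩ := exists_inv_inducedMetric_eq_sum Φ y
  simp only [localGradSq_eq_sum_sq hC, Finset.mul_sum, ← Finset.sum_add_distrib, h]
  refine Finset.sum_le_sum fun k _ => ?_
  have e : ∑ i, C k i * (α * partialDeriv i u y + β * partialDeriv i v y) =
      α * ∑ i, C k i * partialDeriv i u y + β * ∑ i, C k i * partialDeriv i v y := by
    rw [Finset.mul_sum, Finset.mul_sum, ← Finset.sum_add_distrib]
    exact Finset.sum_congr rfl fun i _ => by ring
  simp only [e]
  generalize ∑ i, C k i * partialDeriv i u y = a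
  generalize ∑ i, C k i * partialDeriv i v y = b
  have : 0 ≤ ε⁻¹ * (α * a - ε * (β * b)) ^ 2 := by positivity
  have e2 : ε⁻¹ * (α * a - ε * (β * b)) ^ 2
      = ε⁻¹ * α ^ 2 * a ^ 2 - 2 * α * β * a * b + ε * β ^ 2 * b ^ 2 := by
    field_simp
    ring
  nlinarith

end Local

end EvolvingSubmanifold

namespace EvolvingSubmanifold

/-! ### One-variable derivatives of the logarithmic barrier -/

section Barrier

/-- The logarithm of the localized quantity `(ρ - r)² h² / (f² - k)`. -/
noncomputable def logBarrier (ρ k r h f : ℝ) : ℝ :=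
  2 * Real.log (ρ - r) + (2 * Real.log h + -Real.log (f ^ 2 - k))

theorem hasDerivAt_two_mul_log_sub {ρ a : ℝ} (h : a < ρ) :
    HasDerivAt (fun a => 2 * Real.log (ρ - a)) (-2 / (ρ - a)) a :=
  ((((hasDerivAt_id' a).const_sub ρ).log (sub_pos.2 h).ne').const_mul 2).congr_deriv (by ring)

theorem hasDerivAt_neg_two_div_sub {ρ a : ℝ} (h : a < ρ) :
    HasDerivAt (fun a => -2 / (ρ - a)) (-2 / (ρ - a) ^ 2) a :=
  ((hasDerivAt_const a (-2 : ℝ)).fun_div ((hasDerivAt_id' a).const_sub ρ)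
    (sub_pos.2 h).ne').congr_deriv (by ring)

theorem hasDerivAt_two_mul_log {a : ℝ} (h : 0 < a) :
    HasDerivAt (fun a => 2 * Real.log a) (2 / a) a :=
  ((Real.hasDerivAt_log h.ne').const_mul 2).congr_deriv (by ring)

theorem hasDerivAt_two_div {a : ℝ} (h : 0 < a) :
    HasDerivAt (fun a : ℝ => 2 / a) (-2 / a ^ 2) a :=
  ((hasDerivAt_const a (2 : ℝ)).fun_div (hasDerivAt_id' a) h.ne').congr_deriv (by ring)

theorem hasDerivAt_neg_log_sq_sub {k a : ℝ} (h : k < a ^ 2) :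
    HasDerivAt (fun a => -Real.log (a ^ 2 - k)) (-2 * a / (a ^ 2 - k)) a :=
  ((((hasDerivAt_pow 2 a).sub_const k).log (sub_pos.2 h).ne').fun_neg).congr_deriv
    (by push_cast; ring)

theorem hasDerivAt_neg_two_mul_div_sq_sub {k a : ℝ} (h : k < a ^ 2) :
    HasDerivAt (fun a => -2 * a / (a ^ 2 - k)) ((2 * a ^ 2 + 2 * k) / (a ^ 2 - k) ^ 2) a :=
  (((hasDerivAt_id' a).const_mul (-2)).fun_div ((hasDerivAt_pow 2 a).sub_const k)
    (sub_pos.2 h).ne').congr_deriv (by push_cast; ring)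

/-- The logarithm is monotone and splits the quotient into functions of `r`, `h` and `f` alone, to
which the chain rule applies termwise. -/
theorem logBarrier_le_logBarrier {ρ k s r h f s' r' h' f' : ℝ} (hs : 0 < s) (hr : r < ρ)
    (hh : 0 < h) (hf : k < f ^ 2) (hs' : 0 < s') (hr' : r' < ρ) (hh' : 0 < h') (hf' : k < f' ^ 2)
    (H : s * (ρ - r) ^ 2 * h ^ 2 / (f ^ 2 - k) ≤ s' * (ρ - r') ^ 2 * h' ^ 2 / (f' ^ 2 - k)) :
    Real.log s + logBarrier ρ k r h f ≤ Real.log s' + logBarrier ρ k r' h' f' := by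
  have key : ∀ {s r h f : ℝ}, 0 < s → r < ρ → 0 < h → k < f ^ 2 →
      Real.log s + logBarrier ρ k r h f =
        Real.log (s * (ρ - r) ^ 2 * h ^ 2 / (f ^ 2 - k)) := by
    intro s r h f hs hr hh hf
    have h1 := sub_pos.2 hr
    have h2 := sub_pos.2 hf
    rw [Real.log_div (by positivity) h2.ne', Real.log_mul (by positivity) (by positivity),
      Real.log_mul (by positivity) (by positivity), Real.log_pow, Real.log_pow, logBarrier]
    push_cast
    ring
  rw [key hs hr hh hf, key hs' hr' hh' hf']
  have h1 := sub_pos.2 hr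
  have h2 := sub_pos.2 hf
  exact Real.log_le_log (by positivity) H

end Barrier

/-! ### First and second order conditions for the barrier in space -/

section Local

variable {n N : ℕ} {Φ : EuclideanSpace ℝ (Fin n) → EuclideanSpace ℝ (Fin N)}
  {r h f : EuclideanSpace ℝ (Fin n) → ℝ} {y : EuclideanSpace ℝ (Fin n)} {ρ k : ℝ}

theorem localLaplacian_le_of_isLocalMax_logBarrier (hr : ContDiffAt ℝ 2 r y)
    (hh : ContDiffAt ℝ 2 h y) (hf : ContDiffAt ℝ 2 f y) (hrρ : r y < ρ) (hh0 : 0 < h y)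
    (hf0 : 0 < f y) (hk : 0 < k) (hkf : k < f y ^ 2)
    (hmax : IsLocalMax (fun z => logBarrier ρ k (r z) (h z) (f z)) y) :
    -2 / (ρ - r y) * localLaplacian Φ r y + 2 / h y * localLaplacian Φ h y
      - 2 * f y / (f y ^ 2 - k) * localLaplacian Φ f y ≤
      (4 + 2 * f y ^ 2 / k) * localGradSq Φ r y / (ρ - r y) ^ 2 := by
  have hρ := sub_pos.2 hrρ
  have hfk := sub_pos.2 hkf
  have er : ∀ᶠ a in 𝓝 (r y), HasDerivAt (fun a => 2 * Real.log (ρ - a)) (-2 / (ρ - a)) a :=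
    (eventually_lt_nhds hrρ).mono fun a => hasDerivAt_two_mul_log_sub
  have eh : ∀ᶠ a in 𝓝 (h y), HasDerivAt (fun a => 2 * Real.log a) (2 / a) a :=
    (eventually_gt_nhds hh0).mono fun a => hasDerivAt_two_mul_log
  have ef : ∀ᶠ a in 𝓝 (f y),
      HasDerivAt (fun a => -Real.log (a ^ 2 - k)) (-2 * a / (a ^ 2 - k)) a :=
    ((continuous_pow 2).continuousAt.eventually (eventually_gt_nhds hkf)).mono
      fun a => hasDerivAt_neg_log_sq_sub
  have cr : ContDiffAt ℝ 2 ((fun a => 2 * Real.log (ρ - a)) ∘ r) y :=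
    contDiffAt_const.mul ((contDiffAt_const.sub hr).log hρ.ne')
  have ch : ContDiffAt ℝ 2 ((fun a => 2 * Real.log a) ∘ h) y :=
    contDiffAt_const.mul (hh.log hh0.ne')
  have cf : ContDiffAt ℝ 2 ((fun a => -Real.log (a ^ 2 - k)) ∘ f) y :=
    (((hf.pow 2).sub contDiffAt_const).log hfk.ne').neg
  have hsum : (fun z => logBarrier ρ k (r z) (h z) (f z)) =
      (fun a => 2 * Real.log (ρ - a)) ∘ r +
        ((fun a => 2 * Real.log a) ∘ h + (fun a => -Real.log (a ^ 2 - k)) ∘ f) := rfl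
  rw [hsum] at hmax
  have chf : ContDiffAt ℝ 2 ((fun a => 2 * Real.log a) ∘ h +
      (fun a => -Real.log (a ^ 2 - k)) ∘ f) y := ch.add cf
  have hL := localLaplacian_nonpos_of_isLocalMax (Φ := Φ) hmax (cr.add chf)
  rw [localLaplacian_add cr chf, localLaplacian_add ch cf,
    localLaplacian_comp er (hasDerivAt_neg_two_div_sub hrρ) hr,
    localLaplacian_comp eh (hasDerivAt_two_div hh0) hh,
    localLaplacian_comp ef (hasDerivAt_neg_two_mul_div_sq_sub hkf) hf] at hL
  have hgrad (i : Fin n) : partialDeriv i h y =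
      h y / (ρ - r y) * partialDeriv i r y + h y * f y / (f y ^ 2 - k) * partialDeriv i f y := by
    have h0 := partialDeriv_eq_zero_of_isLocalMax hmax i
    rw [partialDeriv_add (cr.differentiableAt (by simp))
        (chf.differentiableAt (by simp)),
      partialDeriv_add (ch.differentiableAt (by simp)) (cf.differentiableAt (by simp)),
      partialDeriv_comp er.self_of_nhds (hr.differentiableAt (by simp)),
      partialDeriv_comp eh.self_of_nhds (hh.differentiableAt (by simp)),
      partialDeriv_comp ef.self_of_nhds (hf.differentiableAt (by simp))] at h0
    have h1 : h y / 2 * (2 / h y * partialDeriv i h y) = partialDeriv i h y := by field_simp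
    rw [← h1]
    linear_combination (h y / 2) * h0
  -- With this `ε`, `2 (1 + ε) f² = 2f² + 2k` is the numerator of the `|∇f|²` coefficient in `hL`,
  -- so these terms cancel; `1 + ε⁻¹ = 1 + f² / k` gives the coefficient of `|∇r|²`.
  have hQ := localGradSq_le_of_partialDeriv_eq (Φ := Φ) (ε := k / f y ^ 2) (by positivity) hgrad
  have hQ' := mul_le_mul_of_nonneg_left hQ (show 0 ≤ 2 / h y ^ 2 by positivity)
  have e : 2 / h y ^ 2 * ((1 + (k / f y ^ 2)⁻¹) * (h y / (ρ - r y)) ^ 2 * localGradSq Φ r y +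
      (1 + k / f y ^ 2) * (h y * f y / (f y ^ 2 - k)) ^ 2 * localGradSq Φ f y) =
      (4 + 2 * f y ^ 2 / k) * localGradSq Φ r y / (ρ - r y) ^ 2
        - 2 / (ρ - r y) ^ 2 * localGradSq Φ r y
        + (2 * f y ^ 2 + 2 * k) / (f y ^ 2 - k) ^ 2 * localGradSq Φ f y := by
    field_simp
    ring
  rw [e] at hQ'
  have e1 : -2 / (ρ - r y) ^ 2 = -(2 / (ρ - r y) ^ 2) := neg_div _ _
  have e2 : -2 / h y ^ 2 = -(2 / h y ^ 2) := neg_div _ _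
  have e3 : -2 * f y / (f y ^ 2 - k) = -(2 * f y / (f y ^ 2 - k)) := by rw [neg_mul, neg_div]
  rw [e1, e2, e3] at hL
  linarith

end Local

/-! ### Transfer to the manifold, and the condition in time -/

section Immersed

variable {n N : ℕ} {M : Type*} [TopologicalSpace M] [ChartedSpace (EuclideanSpace ℝ (Fin n)) M]

theorem contDiffAt_comp_extChartAt_symm {u : M → ℝ} (hu : ContMDiff (𝓡 n) 𝓘(ℝ, ℝ) 2 u) (x : M) :
    ContDiffAt ℝ 2 (u ∘ (extChartAt (𝓡 n) x).symm) (extChartAt (𝓡 n) x x) := by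
  simpa only [extChartAt_model_space_eq_id, PartialEquiv.refl_coe, Function.id_comp,
    ModelWithCorners.range_eq_univ, contDiffWithinAt_univ] using (contMDiffAt_iff.1 (hu x)).2

theorem laplaceBeltrami_le_of_isLocalMax_logBarrier (F : M → EuclideanSpace ℝ (Fin N))
    {r h f : M → ℝ} {x : M} {ρ k : ℝ} (hr : ContMDiff (𝓡 n) 𝓘(ℝ, ℝ) 2 r)
    (hh : ContMDiff (𝓡 n) 𝓘(ℝ, ℝ) 2 h) (hf : ContMDiff (𝓡 n) 𝓘(ℝ, ℝ) 2 f) (hrρ : r x < ρ)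
    (hh0 : 0 < h x) (hf0 : 0 < f x) (hk : 0 < k) (hkf : k < f x ^ 2)
    (hmax : IsLocalMax (fun z => logBarrier ρ k (r z) (h z) (f z)) x) :
    -2 / (ρ - r x) * laplaceBeltrami (n := n) F r x + 2 / h x * laplaceBeltrami (n := n) F h x
      - 2 * f x / (f x ^ 2 - k) * laplaceBeltrami (n := n) F f x ≤
      (4 + 2 * f x ^ 2 / k) * gradSq (n := n) F r x / (ρ - r x) ^ 2 := by
  have hx (u : M → ℝ) :
      (u ∘ (extChartAt (𝓡 n) x).symm) (extChartAt (𝓡 n) x x) = u x := by simp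
  have hsymm : Tendsto (extChartAt (𝓡 n) x).symm (𝓝 (extChartAt (𝓡 n) x x)) (𝓝 x) := by
    simpa [ContinuousAt] using continuousAt_extChartAt_symm (I := 𝓡 n) x
  have hmax' := localLaplacian_le_of_isLocalMax_logBarrier (ρ := ρ) (k := k)
    (Φ := F ∘ (extChartAt (𝓡 n) x).symm)
    (contDiffAt_comp_extChartAt_symm hr x) (contDiffAt_comp_extChartAt_symm hh x)
    (contDiffAt_comp_extChartAt_symm hf x)
  simp only [hx] at hmax'
  refine hmax' hrρ hh0 hf0 hk hkf ?_
  have := hsymm.eventually hmax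
  simpa [IsLocalMax, IsMaxFilter] using this

/-- At the right end point only the backward direction is admissible, hence an inequality instead of
a vanishing derivative. -/
theorem nonneg_of_isLocalMaxOn_Icc {g : ℝ → ℝ} {g' a b : ℝ} (hab : a < b)
    (hmax : IsLocalMaxOn g (Icc a b) b) (hg : HasDerivWithinAt g g' (Icc a b) b) : 0 ≤ g' := by
  have hcone : a - b ∈ posTangentConeAt (Icc a b) b :=
    sub_mem_posTangentConeAt_of_segment_subset (by rw [segment_symm, segment_eq_Icc hab.le])
  have := hmax.hasFDerivWithinAt_nonpos hg.hasFDerivWithinAt hcone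
  simp only [ContinuousLinearMap.toSpanSingleton_apply, smul_eq_mul] at this
  nlinarith

theorem deriv_nonneg_of_isLocalMaxOn_logBarrier {ρ k T s r' h' f' : ℝ} {r h f : ℝ → ℝ}
    (hs : 0 < s) (hsT : s ≤ T)
    (hr : HasDerivWithinAt r r' (Icc 0 T) s) (hh : HasDerivWithinAt h h' (Icc 0 T) s)
    (hf : HasDerivWithinAt f f' (Icc 0 T) s) (hrρ : r s < ρ) (hh0 : 0 < h s)
    (hkf : k < f s ^ 2)
    (hmax : IsLocalMaxOn (fun τ => Real.log τ + logBarrier ρ k (r τ) (h τ) (f τ)) (Icc 0 s) s) :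
    0 ≤ s⁻¹ + (-2 / (ρ - r s) * r' + (2 / h s * h' + -2 * f s / (f s ^ 2 - k) * f')) := by
  refine nonneg_of_isLocalMaxOn_Icc hs hmax (HasDerivWithinAt.mono ?_ (Icc_subset_Icc_right hsT))
  exact (Real.hasDerivAt_log hs.ne').hasDerivWithinAt.add
    (((hasDerivAt_two_mul_log_sub hrρ).comp_hasDerivWithinAt s hr).add
      (((hasDerivAt_two_mul_log hh0).comp_hasDerivWithinAt s hh).add
        ((hasDerivAt_neg_log_sq_sub hkf).comp_hasDerivWithinAt s hf)))

end Immersed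

end EvolvingSubmanifold

namespace EvolvingSubmanifold

/-! ### Algebra of the estimate -/

section Barrier

theorem barrier_le_of_heat_bounds {c₁ c₃ c₄ c₅ s t ρ k r h f Hr Hh Hf Q : ℝ}
    (hs : 0 < s) (hst : s ≤ t) (hr0 : 0 ≤ r) (hrρ : r < ρ) (hh : 0 < h) (hf : 0 < f)
    (hfc : f ≤ c₃) (hk : 0 < k) (hkf : k < f ^ 2) (hHr : |Hr| ≤ c₄) (hQ : Q ≤ c₅ * r)
    (hHh : Hh ≤ c₁ * h ^ 3) (hHf : c₁ * f * h ^ 2 ≤ Hf)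
    (H : 0 ≤ s⁻¹ + (-2 / (ρ - r) * Hr + (2 / h * Hh + -2 * f / (f ^ 2 - k) * Hf))
      + (4 + 2 * f ^ 2 / k) * Q / (ρ - r) ^ 2) :
    2 * c₁ * k * (s * (ρ - r) ^ 2 * h ^ 2 / (f ^ 2 - k)) ≤
      ρ ^ 2 + 2 * c₄ * t * ρ + (4 + 2 * c₃ ^ 2 / k) * |c₅| * t * ρ := by
  have hd := sub_pos.2 hrρ
  have hfk := sub_pos.2 hkf
  have hc₄ : 0 ≤ c₄ := (abs_nonneg _).trans hHr
  have hQ' : Q ≤ |c₅| * ρ := hQ.trans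
    ((mul_le_mul_of_nonneg_right (le_abs_self _) hr0).trans
      (mul_le_mul_of_nonneg_left hrρ.le (abs_nonneg _)))
  have h1 : -2 / (ρ - r) * Hr ≤ 2 / (ρ - r) * c₄ := by
    rw [neg_div, neg_mul, ← mul_neg]
    exact mul_le_mul_of_nonneg_left ((neg_le_abs _).trans hHr) (by positivity)
  have h2 : 2 / h * Hh ≤ 2 / h * (c₁ * h ^ 3) := mul_le_mul_of_nonneg_left hHh (by positivity)
  have h3 : -2 * f / (f ^ 2 - k) * Hf ≤ -(2 * f / (f ^ 2 - k) * (c₁ * f * h ^ 2)) := by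
    rw [neg_mul, neg_div, neg_mul]
    exact neg_le_neg (mul_le_mul_of_nonneg_left hHf (by positivity))
  have h4 : (4 + 2 * f ^ 2 / k) * Q / (ρ - r) ^ 2 ≤
      (4 + 2 * c₃ ^ 2 / k) * (|c₅| * ρ) / (ρ - r) ^ 2 := by
    have : 0 ≤ |c₅| * ρ := mul_nonneg (abs_nonneg _) (hr0.trans hrρ.le)
    refine div_le_div_of_nonneg_right ?_ (by positivity)
    calc (4 + 2 * f ^ 2 / k) * Q ≤ (4 + 2 * f ^ 2 / k) * (|c₅| * ρ) :=
          mul_le_mul_of_nonneg_left hQ' (by positivity)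
      _ ≤ _ := mul_le_mul_of_nonneg_right (by gcongr) this
  -- The reaction terms of `h` and `f` combine to a negative multiple of the barrier; with `k = 0`
  -- they would cancel.
  have e : 2 / h * (c₁ * h ^ 3) - 2 * f / (f ^ 2 - k) * (c₁ * f * h ^ 2) =
      -(2 * c₁ * k * (h ^ 2 / (f ^ 2 - k))) := by
    field_simp
    ring
  have h5 : 2 * c₁ * k * (h ^ 2 / (f ^ 2 - k)) ≤ s⁻¹ + 2 / (ρ - r) * c₄ +
      (4 + 2 * c₃ ^ 2 / k) * (|c₅| * ρ) / (ρ - r) ^ 2 := by linarith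
  have h6 := mul_le_mul_of_nonneg_left h5 (show 0 ≤ s * (ρ - r) ^ 2 by positivity)
  have e1 : s * (ρ - r) ^ 2 * (2 * c₁ * k * (h ^ 2 / (f ^ 2 - k))) =
      2 * c₁ * k * (s * (ρ - r) ^ 2 * h ^ 2 / (f ^ 2 - k)) := by ring
  have e2 : s * (ρ - r) ^ 2 * (s⁻¹ + 2 / (ρ - r) * c₄ +
      (4 + 2 * c₃ ^ 2 / k) * (|c₅| * ρ) / (ρ - r) ^ 2) =
      (ρ - r) ^ 2 + 2 * c₄ * s * (ρ - r) + (4 + 2 * c₃ ^ 2 / k) * |c₅| * s * ρ := by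
    field_simp
  rw [e1, e2] at h6
  have hρ : 0 ≤ ρ := hr0.trans hrρ.le
  have hdρ : ρ - r ≤ ρ := sub_le_self _ hr0
  have ht : 0 ≤ t := hs.le.trans hst
  refine h6.trans ?_
  gcongr

/-- Evaluation of the bound of `barrier_le_of_heat_bounds`, with `k = m² / 2`, at a point where
`r ≤ θ ρ`. -/
theorem sq_le_of_barrier_le {c₁ c₃ c₄ c₅ t ρ θ m r h f : ℝ} (hc₁ : 0 < c₁) (hc₄ : 0 ≤ c₄)
    (ht : 0 < t) (hρ : 0 < ρ) (hθ : θ < 1) (hm : 0 < m) (hmf : m ≤ f) (hfc : f ≤ c₃)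
    (hr : r ≤ θ * ρ)
    (H : 2 * c₁ * (m ^ 2 / 2) * (t * (ρ - r) ^ 2 * h ^ 2 / (f ^ 2 - m ^ 2 / 2)) ≤
      ρ ^ 2 + 2 * c₄ * t * ρ + (4 + 2 * c₃ ^ 2 / (m ^ 2 / 2)) * |c₅| * t * ρ) :
    h ^ 2 ≤ (2 * c₃ ^ 4 / c₁ * (1 + c₄ + 4 * |c₅|) + 1) * ((1 - θ) ^ 2)⁻¹ * (t⁻¹ + ρ⁻¹) *
      (1 / m ^ 4) := by
  have hθ' := sub_pos.2 hθ
  have hf : 0 < f := hm.trans_le hmf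
  have hmf2 : m ^ 2 ≤ f ^ 2 := by gcongr
  have hfc2 : f ^ 2 ≤ c₃ ^ 2 := by gcongr
  have hm2 : 0 < m ^ 2 := by positivity
  have hD : 0 < f ^ 2 - m ^ 2 / 2 := by linarith
  have hdist : (1 - θ) * ρ ≤ ρ - r := by linarith
  have h1 : c₁ * m ^ 2 * (t * ((1 - θ) * ρ) ^ 2 * h ^ 2 / c₃ ^ 2) ≤
      ρ ^ 2 + 2 * c₄ * t * ρ + (4 + 2 * c₃ ^ 2 / (m ^ 2 / 2)) * |c₅| * t * ρ := by
    refine le_trans ?_ H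
    have e : 2 * c₁ * (m ^ 2 / 2) = c₁ * m ^ 2 := by ring
    rw [e]
    gcongr
    linarith
  have hc : 0 < c₃ := hf.trans_le hfc
  -- The extra factor `m²` clears the `1 / m²` that comes from `k = m² / 2`; together with the `m²`
  -- in `h1` it produces the power `m⁴`.
  have h2 : m ^ 2 * (ρ ^ 2 + 2 * c₄ * t * ρ + (4 + 2 * c₃ ^ 2 / (m ^ 2 / 2)) * |c₅| * t * ρ) ≤
      c₃ ^ 2 * (2 * (1 + c₄ + 4 * |c₅|) * (ρ + t) * ρ) := by
    have e : m ^ 2 * (ρ ^ 2 + 2 * c₄ * t * ρ + (4 + 2 * c₃ ^ 2 / (m ^ 2 / 2)) * |c₅| * t * ρ) =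
      m ^ 2 * (ρ ^ 2 + 2 * c₄ * t * ρ + 4 * |c₅| * t * ρ) + c₃ ^ 2 * (4 * |c₅| * t * ρ) := by
      field_simp
      ring
    have h3 : m ^ 2 * (ρ ^ 2 + 2 * c₄ * t * ρ + 4 * |c₅| * t * ρ) ≤
        c₃ ^ 2 * (ρ ^ 2 + 2 * c₄ * t * ρ + 4 * |c₅| * t * ρ) := by
      gcongr
      exact hmf.trans hfc
    rw [e]
    refine (add_le_add_left h3 _).trans ?_
    rw [← mul_add]
    gcongr
    have : 0 ≤ c₄ * ρ * ρ := by positivity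
    have : 0 ≤ |c₅| * ρ * ρ := by positivity
    have : 0 < t * ρ := by positivity
    have : 0 < ρ * ρ := by positivity
    nlinarith
  have h3 := (mul_le_mul_of_nonneg_left h1 hm2.le).trans h2
  have h4 : h ^ 2 ≤ 2 * c₃ ^ 4 / c₁ * (1 + c₄ + 4 * |c₅|) * ((1 - θ) ^ 2)⁻¹ * (t⁻¹ + ρ⁻¹) *
      (1 / m ^ 4) := by
    have e1 : m ^ 2 * (c₁ * m ^ 2 * (t * ((1 - θ) * ρ) ^ 2 * h ^ 2 / c₃ ^ 2)) =
        h ^ 2 * (c₁ * m ^ 4 * t * ((1 - θ) * ρ) ^ 2 / c₃ ^ 2) := by ring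
    have hpos : 0 < c₁ * m ^ 4 * t * ((1 - θ) * ρ) ^ 2 / c₃ ^ 2 := by positivity
    rw [e1, ← le_div_iff₀ hpos] at h3
    refine h3.trans_eq ?_
    field_simp
  refine h4.trans ?_
  gcongr
  linarith

end Barrier

/-! ### The maximum principle and the choice of `k` -/

section Immersed

variable {n N : ℕ} {M : Type*} [TopologicalSpace M] [ChartedSpace (EuclideanSpace ℝ (Fin n)) M]

/-- Maximum principle: at a positive maximum of `s (ρ - r)² h² / (f² - k)` over the set
`{r ≤ ρ}`, the first and second order conditions bound this quantity. -/
theorem barrier_le_of_isMaxOn {c₁ c₃ c₄ c₅ T t ρ k s : ℝ} {x : M}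
    {F : ℝ → M → EuclideanSpace ℝ (Fin N)} {r h f : ℝ → M → ℝ}
    (hr : IsRegular n T r) (hh : IsRegular n T h) (hf : IsRegular n T f)
    (hr0 : ∀ s ∈ Icc 0 T, ∀ x, 0 ≤ r s x)
    (hHr : ∀ s ∈ Icc 0 T, ∀ x, |heatOp (n := n) T F r s x| ≤ c₄)
    (hQ : ∀ s ∈ Icc 0 T, ∀ x, gradSq (n := n) (F s) (r s) x ≤ c₅ * r s x)
    (hh0 : ∀ s ∈ Icc 0 T, ∀ x, 0 < h s x)
    (hf0 : ∀ s ∈ Icc 0 T, ∀ x, 0 < f s x ∧ f s x ≤ c₃)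
    (hHh : ∀ s ∈ Icc 0 T, ∀ x, heatOp (n := n) T F h s x ≤ c₁ * h s x ^ 3)
    (hHf : ∀ s ∈ Icc 0 T, ∀ x, c₁ * f s x * h s x ^ 2 ≤ heatOp (n := n) T F f s x)
    (htT : t ≤ T) (hk : 0 < k)
    (hkf : ∀ s ∈ Icc 0 t, ∀ x, r s x ≤ ρ → k < f s x ^ 2)
    (hs : 0 < s) (hst : s ≤ t) (hrρ : r s x < ρ)
    (hmax : ∀ s' ∈ Icc 0 t, ∀ x', r s' x' ≤ ρ →
      s' * (ρ - r s' x') ^ 2 * h s' x' ^ 2 / (f s' x' ^ 2 - k) ≤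
        s * (ρ - r s x) ^ 2 * h s x ^ 2 / (f s x ^ 2 - k)) :
    2 * c₁ * k * (s * (ρ - r s x) ^ 2 * h s x ^ 2 / (f s x ^ 2 - k)) ≤
      ρ ^ 2 + 2 * c₄ * t * ρ + (4 + 2 * c₃ ^ 2 / k) * |c₅| * t * ρ := by
  have hsT : s ≤ T := hst.trans htT
  have hsI : s ∈ Icc 0 T := ⟨hs.le, hsT⟩
  have hsI' : s ∈ Icc 0 t := ⟨hs.le, hst⟩
  have hkf' := hkf s hsI' x hrρ.le
  have hspace : IsLocalMax (fun z => logBarrier ρ k (r s z) (h s z) (f s z)) x := by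
    filter_upwards [(hr.space s hsI).continuous.continuousAt.eventually (eventually_lt_nhds hrρ)]
      with z hz
    have := logBarrier_le_logBarrier hs hz (hh0 s hsI z) (hkf s hsI' z hz.le) hs hrρ
      (hh0 s hsI x) hkf' (hmax s hsI' z hz.le)
    linarith
  have htime : IsLocalMaxOn
      (fun τ => Real.log τ + logBarrier ρ k (r τ x) (h τ x) (f τ x)) (Icc 0 s) s := by
    have hcont : ContinuousWithinAt (fun τ => r τ x) (Icc 0 s) s :=
      ((hr.time x).continuousOn s hsI).mono (Icc_subset_Icc_right hsT)
    filter_upwards [hcont.eventually (eventually_lt_nhds hrρ),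
      nhdsWithin_le_nhds (eventually_gt_nhds hs), self_mem_nhdsWithin] with τ h1 h2 h3
    have hτ : τ ∈ Icc 0 t := ⟨h3.1, h3.2.trans hst⟩
    exact logBarrier_le_logBarrier h2 h1 (hh0 τ ⟨hτ.1, hτ.2.trans htT⟩ x) (hkf τ hτ x h1.le) hs hrρ
      (hh0 s hsI x) hkf' (hmax τ hτ x h1.le)
  have hL := laplaceBeltrami_le_of_isLocalMax_logBarrier (F s) (hr.space s hsI) (hh.space s hsI)
    (hf.space s hsI) hrρ (hh0 s hsI x) (hf0 s hsI x).1 hk hkf' hspace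
  have hD := deriv_nonneg_of_isLocalMaxOn_logBarrier hs hsT
    ((hr.time x) s hsI).hasDerivWithinAt ((hh.time x) s hsI).hasDerivWithinAt
    ((hf.time x) s hsI).hasDerivWithinAt hrρ (hh0 s hsI x) hkf' htime
  refine barrier_le_of_heat_bounds hs hst (hr0 s hsI x) hrρ (hh0 s hsI x) (hf0 s hsI x).1
    (hf0 s hsI x).2 hk hkf' (hHr s hsI x) (hQ s hsI x) (hHh s hsI x) (hHf s hsI x) ?_
  have e : -2 * f s x / (f s x ^ 2 - k) = -(2 * f s x / (f s x ^ 2 - k)) := by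
    rw [neg_mul, neg_div]
  simp only [heatOp]
  rw [e] at hD ⊢
  linarith

theorem exists_sq_le_of_heat_bounds {c₁ c₃ c₄ c₅ T t ρ θ : ℝ} (hc₁ : 0 < c₁)
    {F : ℝ → M → EuclideanSpace ℝ (Fin N)} {r h f : ℝ → M → ℝ}
    (hr : IsRegular n T r) (hh : IsRegular n T h) (hf : IsRegular n T f)
    (hr0 : ∀ s ∈ Icc 0 T, ∀ x, 0 ≤ r s x)
    (hHr : ∀ s ∈ Icc 0 T, ∀ x, |heatOp (n := n) T F r s x| ≤ c₄)
    (hQ : ∀ s ∈ Icc 0 T, ∀ x, gradSq (n := n) (F s) (r s) x ≤ c₅ * r s x)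
    (hh0 : ∀ s ∈ Icc 0 T, ∀ x, 0 < h s x)
    (hf0 : ∀ s ∈ Icc 0 T, ∀ x, 0 < f s x ∧ f s x ≤ c₃)
    (hHh : ∀ s ∈ Icc 0 T, ∀ x, heatOp (n := n) T F h s x ≤ c₁ * h s x ^ 3)
    (hHf : ∀ s ∈ Icc 0 T, ∀ x, c₁ * f s x * h s x ^ 2 ≤ heatOp (n := n) T F f s x)
    (ht : 0 < t) (htT : t ≤ T) (hρ : 0 < ρ)
    (hK : IsCompact {p : M × ℝ | p.2 ∈ Icc 0 t ∧ r p.2 p.1 ≤ ρ}) (hθ : θ < 1)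
    {x : M} (hx : r t x ≤ θ * ρ) :
    ∃ s ∈ Icc 0 t, ∃ z, r s z ≤ ρ ∧
      h t x ^ 2 ≤ (2 * c₃ ^ 4 / c₁ * (1 + |c₄| + 4 * |c₅|) + 1) * ((1 - θ) ^ 2)⁻¹ * (t⁻¹ + ρ⁻¹) *
        (1 / f s z ^ 4) := by
  set K := {p : M × ℝ | p.2 ∈ Icc 0 t ∧ r p.2 p.1 ≤ ρ} with hKdef
  have hKT : K ⊆ univ ×ˢ Icc 0 T := fun p hp => ⟨mem_univ _, hp.1.1, hp.1.2.trans htT⟩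
  have htI : t ∈ Icc 0 T := ⟨ht.le, htT⟩
  have hxρ : r t x < ρ := hx.trans_lt (by nlinarith)
  have hxK : (x, t) ∈ K := ⟨⟨ht.le, le_rfl⟩, hxρ.le⟩
  have hcr := hr.continuousOn.mono hKT
  have hch := hh.continuousOn.mono hKT
  have hcf := hf.continuousOn.mono hKT
  -- The witness is a minimum point of `f`. Half of the squared minimum, `k = m² / 2`, keeps `f² -
  -- k` positive on `K`.
  obtain ⟨⟨z, σ⟩, hzK, hzmin⟩ := hK.exists_isMinOn ⟨_, hxK⟩ hcf
  refine ⟨σ, hzK.1, z, hzK.2, ?_⟩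
  have hm : 0 < f σ z := (hf0 σ (hKT hzK).2 z).1
  have hmin (s : ℝ) (hs : s ∈ Icc 0 t) (y : M) (hy : r s y ≤ ρ) : f σ z ≤ f s y :=
    hzmin (show (y, s) ∈ K from ⟨hs, hy⟩)
  set m := f σ z
  have hkf (s : ℝ) (hs : s ∈ Icc 0 t) (y : M) (hy : r s y ≤ ρ) : m ^ 2 / 2 < f s y ^ 2 := by
    have : m ^ 2 ≤ f s y ^ 2 := pow_le_pow_left₀ hm.le (hmin s hs y hy) 2
    have : 0 < m ^ 2 := by positivity
    linarith
  obtain ⟨⟨y, s⟩, hyK, hymax⟩ := hK.exists_isMaxOn ⟨_, hxK⟩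
    (f := fun p : M × ℝ => p.2 * (ρ - r p.2 p.1) ^ 2 * h p.2 p.1 ^ 2 / (f p.2 p.1 ^ 2 - m ^ 2 / 2))
    (((continuousOn_snd.mul ((continuousOn_const.sub hcr).pow 2)).mul (hch.pow 2)).div
      ((hcf.pow 2).sub continuousOn_const)
      fun p hp => (sub_pos.2 (hkf p.2 hp.1 p.1 hp.2)).ne')
  have hmax (s' : ℝ) (hs' : s' ∈ Icc 0 t) (y' : M) (hy' : r s' y' ≤ ρ) :
      s' * (ρ - r s' y') ^ 2 * h s' y' ^ 2 / (f s' y' ^ 2 - m ^ 2 / 2) ≤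
        s * (ρ - r s y) ^ 2 * h s y ^ 2 / (f s y ^ 2 - m ^ 2 / 2) :=
    hymax (show (y', s') ∈ K from ⟨hs', hy'⟩)
  have hxmax := hmax t hxK.1 x hxρ.le
  have hpos : 0 < s * (ρ - r s y) ^ 2 * h s y ^ 2 / (f s y ^ 2 - m ^ 2 / 2) := by
    have h1 := sub_pos.2 hxρ
    have h2 := sub_pos.2 (hkf t hxK.1 x hxρ.le)
    have h3 := hh0 t htI x
    exact lt_of_lt_of_le (by positivity) hxmax
  -- The barrier vanishes at `s = 0` and at `r = ρ`, so a positive maximum avoids both.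
  have hs : 0 < s := lt_of_le_of_ne hyK.1.1 fun h0 => by simp [← h0] at hpos
  have hyρ : r s y < ρ := lt_of_le_of_ne hyK.2 fun h0 => by simp [h0] at hpos
  have hbound := barrier_le_of_isMaxOn hr hh hf hr0 hHr hQ hh0 hf0 hHh hHf htT
    (show 0 < m ^ 2 / 2 by positivity) hkf hs hyK.1.2 hyρ hmax
  have hc₄ : 0 ≤ c₄ := (abs_nonneg _).trans (hHr t htI x)
  rw [abs_of_nonneg hc₄]
  exact sq_le_of_barrier_le hc₁ hc₄ ht hρ hθ hm (hmin t hxK.1 x hxρ.le) (hf0 t htI x).2 hx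
    ((mul_le_mul_of_nonneg_left hxmax (by positivity)).trans hbound)

end Immersed

end EvolvingSubmanifold

theorem lemma4p1 (c₁ c₃ c₄ c₅ : ℝ) (hc₁ : 0 < c₁) :
    ∃ c₀ : ℝ, 0 < c₀ ∧
      ∀ (n m : ℕ) (M : Type*) [TopologicalSpace M] [T2Space M]
        [ChartedSpace (EuclideanSpace ℝ (Fin n)) M] [IsManifold (𝓡 n) ∞ M]
        (T : ℝ) (F : ℝ → M → EuclideanSpace ℝ (Fin (n + m)))
        (_ : EvolvingSubmanifold.IsMeanCurvatureFlow (n := n) T F)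
        (r h f : ℝ → M → ℝ)
        (_ : EvolvingSubmanifold.IsRegular n T r)
        (_ : EvolvingSubmanifold.IsRegular n T h)
        (_ : EvolvingSubmanifold.IsRegular n T f)
        (_ : ∀ s ∈ Icc 0 T, ∀ x, 0 ≤ r s x)
        (_ : ∀ s ∈ Icc 0 T, ∀ x, |EvolvingSubmanifold.heatOp (n := n) T F r s x| ≤ c₄)
        (_ : ∀ s ∈ Icc 0 T, ∀ x,
          EvolvingSubmanifold.gradSq (n := n) (F s) (r s) x ≤ c₅ * r s x)
        (_ : ∀ s ∈ Icc 0 T, ∀ x, 0 < h s x)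
        (_ : ∀ s ∈ Icc 0 T, ∀ x, 0 < f s x ∧ f s x ≤ c₃)
        (_ : ∀ s ∈ Icc 0 T, ∀ x,
          EvolvingSubmanifold.heatOp (n := n) T F h s x ≤ c₁ * h s x ^ 3)
        (c₂ : ℝ) (_ : c₁ ≤ c₂)
        (_ : ∀ s ∈ Icc 0 T, ∀ x,
          c₂ * f s x * h s x ^ 2 ≤ EvolvingSubmanifold.heatOp (n := n) T F f s x)
        (t : ℝ) (_ : 0 < t) (_ : t ≤ T)
        (R : ℝ) (_ : 0 < R)
        (_ : IsCompact {p : M × ℝ | p.2 ∈ Icc 0 t ∧ r p.2 p.1 ≤ R ^ 2})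
        (θ : ℝ) (_ : 0 < θ) (_ : θ < 1),
        (⨆ x ∈ {x : M | r t x ≤ θ * R ^ 2}, ENNReal.ofReal (h t x ^ 2)) ≤
          ENNReal.ofReal (c₀ * ((1 - θ) ^ 2)⁻¹ * (t⁻¹ + (R ^ 2)⁻¹)) *
            ⨆ s ∈ Icc 0 t, ⨆ x ∈ {x : M | r s x ≤ R ^ 2}, ENNReal.ofReal (1 / f s x ^ 4) := by
  -- The summand `1` keeps the constant positive when `c₃ = 0`, and the absolute values do so for
  -- `c₄` and `c₅` of either sign.
  refine ⟨2 * c₃ ^ 4 / c₁ * (1 + |c₄| + 4 * |c₅|) + 1, by positivity, ?_⟩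
  intro n m M _ _ _ _ T F _ r h f hr hh hf hr0 hHr hQ hh0 hf0 hHh c₂ hc₂ hHf t ht htT R hR hK θ _ hθ
  have hHf' : ∀ s ∈ Icc 0 T, ∀ x, c₁ * f s x * h s x ^ 2 ≤
      EvolvingSubmanifold.heatOp (n := n) T F f s x := fun s hs x => by
    refine le_trans ?_ (hHf s hs x)
    have := (hf0 s hs x).1
    gcongr
  refine iSup₂_le fun x hx => ?_
  obtain ⟨s, hs, z, hz, hle⟩ := EvolvingSubmanifold.exists_sq_le_of_heat_bounds hc₁ hr hh hf hr0
    hHr hQ hh0 hf0 hHh hHf' ht htT (pow_pos hR 2) hK hθ hx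
  have hθ' := sub_pos.2 hθ
  refine (ENNReal.ofReal_le_ofReal hle).trans ?_
  rw [ENNReal.ofReal_mul (by positivity)]
  gcongr
  exact le_iSup₂_of_le s hs (le_iSup₂_of_le z hz le_rfl)
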